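/- Let $\mathcal B=\mathbb C^2$. A quantum operation is a trace-preserving completely positive linear map. A quantum circuit $Q$ with gates of fan-in at most $k$ is a sequence of quantum operations $$\mathcal B^{\otimes n_0}\xrightarrow{T_0}\mathcal B^{\otimes n_1}\xrightarrow{T_1}\cdots\xrightarrow{T_{t-1}}\mathcal B^{\otimes n_t},$$ in which every $T_i$ is a tensor product, along partitions of the input and output qubits into (possibly empty) blocks, of quantum operations each acting on at most $k$ input qubits. Put $\mathrm{Depth}(Q)=t$ and $\mathrm{Width}(Q)=\max\{n_0,\dots,n_t\}$. Let $\mathcal E_\eta(\rho)=(1-\eta)\rho+\eta\,\mathrm{tr}(\rho)I/2$ be the depolarization of one qubit at rate $\eta\in[0,1]$. The perturbed circuit is $$Q_\eta=T_{t-1}\,\mathcal E_\eta^{\otimes n_{t-1}}\,T_{t-2}\cdots T_1\,\mathcal E_\eta^{\otimes n_1}\,T_0 .$$ Let $D(\rho,\sigma)=\frac12\|\rho-\sigma\|_{\mathrm{tr}}$ be the trace distance. $Q_\eta$ is practically worthless if $D(Q_\eta(\rho),Q_\eta(\sigma))\le 1/100$ for all density matrices $\rho,\sigma$ on $\mathcal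 B^{\otimes n_0}$. **Theorem.** (1) For every integer $k\ge1$ and every $\eta$ with $1-\frac1k<\eta\le1$ there are constants $C,K>0$ such that the following holds for every quantum circuit $Q$ with gates of fan-in at most $k$. (a) If $\mathrm{Depth}(Q)\ge C\log\mathrm{Width}(Q)$ (and, in case $\mathrm{Width}(Q)=1$, also $\mathrm{Depth}(Q)\ge C$), then $Q_\eta$ is practically worthless. (Here $\log 0=0$.) (b) If $\mathrm{Depth}(Q)\ge C\log n_t$, then $n_t\cdot D(Q_\eta(\rho),Q_\eta(\sigma))\le K$ for all density matrices $\rho,\sigma$ on $\mathcal B^{\otimes n_0}$; that is, the outputs are within trace distance $O(1/n_t)$. (2) A family of functions $f_n:\{0,1\}^n\to\{0,1\}$ ($n\ge 0$) is computed by a family of circuits with $n$ input qubits, each with a designated output qubit, if for every $x\in\{0,1\}^n$, when the $n$-th circuit is run on $|x\rangle\langle x|$ and its output qubit is measured in the computational basis, the outcome is $f_n(x)$ with probability at least $2/3$. Let $\mathbf{QP}$ be the set of families $(f_n)$ computed by (not necessarily uniform) families of quantum circuits with gates of fan-in at most $2$ and of polynomial size (equivalently, of polynomially bounded depth and width), and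 let $\mathbf{QNC}^1$ be the set of those computed by such families of polynomial size whose depth is moreover $O(\log n)$. Let $\eta_0$ be the supremum of those $\eta\in[0,1]$ for which every $(f_n)\in\mathbf{QP}$ is computed by the perturbed circuits $(Q_n)_\eta$ for some polynomial-size family $(Q_n)$ with gates of fan-in at most $2$. If $\mathbf{QP}\not\subseteq\mathbf{QNC}^1$, then $\eta_0\le\frac12$. -/

import Mathlib

open scoped Matrix ComplexOrder

noncomputable section

namespace NoisyCircuit

/-! ### States and quantum operations -/

/-- Linear operators on `ℂ^m`, written as matrices in the standard basis. -/
abbrev Operator (m : Type) : Type := Matrix m m ℂ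

/-- The computational basis of the space `𝓑^{⊗ι}` of the qubits labelled by `ι`: the bit strings
on `ι`. Thus `Operator (Bits ι)` is the space of linear operators on `𝓑^{⊗ι}`. -/
abbrev Bits (ι : Type) : Type := ι → Fin 2

/-- Density matrices: Hermitian positive semidefinite of trace one
(`Matrix.PosSemidef` includes being Hermitian). -/
def IsDensity {m : Type} [Fintype m] (ρ : Operator m) : Prop :=
  ρ.PosSemidef ∧ ρ.trace = 1

/-- The map `id ⊗ T` on operators on `ℂ^r ⊗ ℂ^m`: apply `T` to each of the `r × r` blocks. -/
def ampliate {m n : Type} (r : ℕ) (T : Operator m →ₗ[ℂ] Operator n)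
    (X : Operator (Fin r × m)) : Operator (Fin r × n) :=
  Matrix.of fun p q => T (Matrix.of fun i j => X (p.1, i) (q.1, j)) p.2 q.2

/-- Quantum operations: trace preserving, completely positive linear maps. -/
structure IsQuantumOperation {m n : Type} [Fintype m] [Fintype n]
    (T : Operator m →ₗ[ℂ] Operator n) : Prop where
  trace_preserving : ∀ X : Operator m, (T X).trace = X.trace
  completely_positive : ∀ (r : ℕ) (X : Operator (Fin r × m)),
    X.PosSemidef → (ampliate r T X).PosSemidef

/-- The trace norm: the sum of the singular values, i.e. of the square roots of the
eigenvalues of `Aᴴ A`. -/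
def traceNorm {m : Type} [Fintype m] [DecidableEq m] (A : Operator m) : ℝ :=
  ∑ i, Real.sqrt ((Matrix.isHermitian_conjTranspose_mul_self A).eigenvalues i)

/-- The trace distance. -/
def traceDist {m : Type} [Fintype m] [DecidableEq m] (ρ σ : Operator m) : ℝ :=
  1 / 2 * traceNorm (ρ - σ)

/-! ### Tensor products of operations along partitions of the qubits -/

/-- The operator `⨂_ν X_ν` on the qubits `ι`, where `X_ν` acts on the block `a⁻¹(ν)` of the
partition of `ι` (into possibly empty blocks) given by the labelling `a`. -/
def tensorState {ι : Type} {w : ℕ} (a : ι → Fin w)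
    (X : ∀ ν : Fin w, Operator (Bits {i // a i = ν})) : Operator (Bits ι) :=
  Matrix.of fun x y => ∏ ν : Fin w, X ν (fun i => x i) (fun i => y i)

/-- The tensor product `⨂_ν G_ν`, where `G_ν` maps operators on the block `a⁻¹(ν)` of the
input qubits to operators on the block `b⁻¹(ν)` of the output qubits. It is the linear map sending
each matrix unit `|x⟩⟨y| = ⨂_ν |x_ν⟩⟨y_ν|` to `⨂_ν G_ν(|x_ν⟩⟨y_ν|)`. -/
def tensorOperation {ι κ : Type} [Fintype ι] [DecidableEq ι] {w : ℕ}
    (a : ι → Fin w) (b : κ → Fin w)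
    (G : ∀ ν : Fin w, Operator (Bits {i // a i = ν}) →ₗ[ℂ] Operator (Bits {j // b j = ν})) :
    Operator (Bits ι) →ₗ[ℂ] Operator (Bits κ) where
  toFun X := ∑ x : Bits ι, ∑ y : Bits ι,
    X x y • tensorState b fun ν => G ν (Matrix.single (fun i => x i) (fun i => y i) 1)
  map_add' X Y := by
    simp only [Matrix.add_apply, add_smul, Finset.sum_add_distrib]
  map_smul' c X := by
    simp only [Matrix.smul_apply, smul_assoc, Finset.smul_sum, RingHom.id_apply]

/-! ### Depolarizing noise -/

/-- Depolarization at rate `η`: `X ↦ (1 - η) X + (η tr X / dim) I`. -/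
def depolarize {m : Type} [Fintype m] [DecidableEq m] (η : ℝ) : Operator m →ₗ[ℂ] Operator m where
  toFun X := (1 - (η : ℂ)) • X + ((η : ℂ) * X.trace / (Fintype.card m : ℂ)) • (1 : Operator m)
  map_add' X Y := by
    rw [Matrix.trace_add, smul_add, mul_add, add_div, add_smul]
    abel
  map_smul' c X := by
    simp only [Matrix.trace_smul, smul_add, smul_smul, RingHom.id_apply, smul_eq_mul]
    congr 2 <;> ring

/-- The operation depolarizing each of `n` qubits independently at rate `η`: the tensor product of
`n` copies of the one-qubit depolarization. -/
def qubitNoise (η : ℝ) (n : ℕ) : Operator (Bits (Fin n)) →ₗ[ℂ] Operator (Bits (Fin n)) :=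
  tensorOperation id id fun _ => depolarize η

/-! ### Circuits -/

/-- `T` is one level of a circuit over the gates of fan-in at most `k`: it is a tensor
product, along partitions of the input and of the output qubits into possibly empty blocks, of
quantum operations each having at most `k` input qubits. -/
def IsLevel (k : ℕ) {n m : ℕ}
    (T : Operator (Bits (Fin n)) →ₗ[ℂ] Operator (Bits (Fin m))) : Prop :=
  ∃ (w : ℕ) (a : Fin n → Fin w) (b : Fin m → Fin w)
    (G : ∀ ν : Fin w, Operator (Bits {i // a i = ν}) →ₗ[ℂ] Operator (Bits {j // b j = ν})),
    (∀ ν, IsQuantumOperation (G ν) ∧ Fintype.card {i // a i = ν} ≤ k) ∧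
      T = tensorOperation a b G

/-- Mixed-state quantum circuits over the gates of fan-in at most `k`, with `n` input qubits and
`m` output qubits: finite sequences of levels, built up from the input end. -/
inductive Circuit (k : ℕ) (n : ℕ) : ℕ → Type
  | empty : Circuit k n n
  | step {m l : ℕ} (Q : Circuit k n m)
      (T : Operator (Bits (Fin m)) →ₗ[ℂ] Operator (Bits (Fin l))) (hT : IsLevel k T) :
      Circuit k n l

namespace Circuit

/-- The number of levels of the circuit. -/
def depth {k n : ℕ} : {m : ℕ} → Circuit k n m → ℕ
  | _, empty => 0
  | _, step Q _ _ => Q.depth + 1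

/-- The largest number of qubits present at any stage, including the input and the output. -/
def width {k n : ℕ} : {m : ℕ} → Circuit k n m → ℕ
  | _, empty => n
  | _, step (l := l) Q _ _ => max Q.width l

/-- The operation computed by the noiseless circuit. -/
def run {k n : ℕ} : {m : ℕ} → Circuit k n m →
    (Operator (Bits (Fin n)) →ₗ[ℂ] Operator (Bits (Fin m)))
  | _, empty => LinearMap.id
  | _, step Q T _ => T ∘ₗ Q.run

/-- The operation computed by the perturbed circuit: all qubits are independently
depolarized at rate `η` between any two consecutive levels (not before the first level
and not after the last one). -/
def noisyRun {k n : ℕ} (η : ℝ) : {m : ℕ} → Circuit k n m →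
    (Operator (Bits (Fin n)) →ₗ[ℂ] Operator (Bits (Fin m)))
  | _, empty => LinearMap.id
  | _, step (m := m) Q T _ =>
      if Q.depth = 0 then T ∘ₗ Q.noisyRun η else T ∘ₗ qubitNoise η m ∘ₗ Q.noisyRun η

end Circuit

/-- The operation `F` computed by a (perturbed) circuit is practically worthless: any two
input states give outputs within trace distance `1/100`. -/
def PracticallyWorthless {n m : ℕ}
    (F : Operator (Bits (Fin n)) →ₗ[ℂ] Operator (Bits (Fin m))) : Prop :=
  ∀ ρ σ : Operator (Bits (Fin n)), IsDensity ρ → IsDensity σ → traceDist (F ρ) (F σ) ≤ 1 / 100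

/-! ### Computing Boolean functions, complexity classes, and the threshold -/

/-- The state `|x⟩⟨x|`. -/
def basisState {n : ℕ} (x : Bits (Fin n)) : Operator (Bits (Fin n)) := Matrix.single x x 1

/-- The probability of the outcome `1` when qubit `j` of the state `ρ` is measured in the
computational basis. -/
def probOne {m : ℕ} (ρ : Operator (Bits (Fin m))) (j : Fin m) : ℝ :=
  ∑ y : Bits (Fin m), if y j = 1 then (ρ y y).re else 0

/-- Measuring the output qubit `j` of `F` run on the classical input `x` gives `f x` with
probability at least `2/3`, for every `x`. -/
def Computes {n m : ℕ} (F : Operator (Bits (Fin n)) →ₗ[ℂ] Operator (Bits (Fin m))) (j : Fin m)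
    (f : Bits (Fin n) → Fin 2) : Prop :=
  ∀ x, (f x = 1 → 2 / 3 ≤ probOne (F (basisState x)) j) ∧
    (f x = 0 → probOne (F (basisState x)) j ≤ 1 / 3)

/-- Boolean functions (on inputs of all lengths). -/
abbrev BooleanFunction : Type := ∀ n : ℕ, Bits (Fin n) → Fin 2

/-- Boolean functions computed with bounded error by polynomial-size quantum circuits with gates of
fan-in at most 2. A family of circuits has polynomial size if and only if its depth and
its width are polynomially bounded. -/
def QP : Set BooleanFunction :=
  {f | ∃ p : Polynomial ℕ, ∀ n, ∃ (m : ℕ) (Q : Circuit 2 n m) (j : Fin m),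
    Q.depth ≤ p.eval n ∧ Q.width ≤ p.eval n ∧ Computes Q.run j (f n)}

/-- Boolean functions computed with bounded error by polynomial-size quantum circuits of
logarithmic depth with gates of fan-in at most 2. -/
def QNC1 : Set BooleanFunction :=
  {f | ∃ (p : Polynomial ℕ) (c : ℝ), ∀ n, ∃ (m : ℕ) (Q : Circuit 2 n m) (j : Fin m),
    (Q.depth : ℝ) ≤ c * Real.log (n + 2) ∧ Q.width ≤ p.eval n ∧ Computes Q.run j (f n)}

/-- Boolean functions computed with bounded error by polynomial-size quantum circuits with gates of
fan-in at most 2 whose qubits are subject to depolarizing noise at rate `η`. -/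
def NoisyQP (η : ℝ) : Set BooleanFunction :=
  {f | ∃ p : Polynomial ℕ, ∀ n, ∃ (m : ℕ) (Q : Circuit 2 n m) (j : Fin m),
    Q.depth ≤ p.eval n ∧ Q.width ≤ p.eval n ∧ Computes (Q.noisyRun η) j (f n)}

/-- The fault-tolerance threshold `η₀`: the supremum of those rates `η` for which all polynomial-size
quantum computations can be simulated by polynomial-size circuits tolerating noise at rate `η`. -/
def faultToleranceThreshold : ℝ :=
  sSup {η : ℝ | 0 ≤ η ∧ η ≤ 1 ∧ QP ⊆ NoisyQP η}

end NoisyCircuit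

end

open NoisyCircuit

namespace NoisyCircuit

/-! The proof works in the Heisenberg picture. An observable supported on `L` factors through the
partial trace onto `L`. Pulling it back through a level enlarges its support at most `k`-fold. Noise
is a random erasure in which each qubit survives with probability `1 - η`, so the mean support
shrinks by `1 - η`. The invariant `LocallyBounded`, a bound linear in `L.card`, passes through this
average (`LocallyBounded.level`, `LocallyBounded.qubitNoise`). It starts at `2` for a difference of
states. After `t ≥ 1` levels, with only `t - 1` noise layers between them, it is at most `2 * k * r
^ (t - 1)` for any `r ≥ k * (1 - η)`.

Testing all `m` output qubits with an observable attaining the trace norm costs a factor `m`, which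
logarithmic depth absorbs; this gives (1). Testing one output qubit costs nothing in the width. So
for `k = 2` and `η > 1/2`, a noisy circuit deeper than some constant cannot tell inputs apart and
computes a constant function, while a shallower one is simulated noiselessly in constant depth.
Hence `NoisyQP η ⊆ QNC1`, which gives (2). -/

/-! ### Kraus decompositions -/

/-- `T` has an operator-sum decomposition `X ↦ ∑ s, K s * X * (K s)ᴴ`, stated on matrix units. -/
def HasKraus {m n : Type} [DecidableEq m] (T : Operator m →ₗ[ℂ] Operator n) : Prop :=
  ∃ (S : Type) (_ : Fintype S) (K : S → Matrix n m ℂ), ∀ i j p q,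
    T (Matrix.single i j 1) p q = ∑ s, K s p i * star (K s q j)

open scoped MatrixOrder Matrix.Norms.L2Operator in
theorem exists_eq_conjTranspose_mul_self {m : Type} [Fintype m] [DecidableEq m] {A : Operator m}
    (hA : A.PosSemidef) : ∃ B : Operator m, A = Bᴴ * B :=
  CStarAlgebra.nonneg_iff_eq_star_mul_self.mp hA.nonneg

/-- Choi's argument: the image of a maximally entangled state is positive semidefinite, and the rows
of a factor `B` in `Bᴴ * B` are, up to conjugation, the Kraus operators. -/
theorem IsQuantumOperation.hasKraus {m n : Type} [Fintype m] [DecidableEq m] [Fintype n]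
    {T : Operator m →ₗ[ℂ] Operator n} (hT : IsQuantumOperation T) : HasKraus T := by
  classical
  let e : m ≃ Fin (Fintype.card m) := Fintype.equivFin m
  -- The unnormalized maximally entangled vector: block `(e i, e j)` of its projector is the matrix
  -- unit at `(i, j)`.
  let v : Fin (Fintype.card m) × m → ℂ := fun p => if e.symm p.1 = p.2 then 1 else 0
  have hC := hT.completely_positive (Fintype.card m) _ (Matrix.posSemidef_vecMulVec_self_star v)
  obtain ⟨B, hB⟩ := exists_eq_conjTranspose_mul_self hC
  refine ⟨_, inferInstance, fun s => Matrix.of fun p i => star (B s (e i, p)), fun i j p q => ?_⟩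
  have h := congrFun (congrFun hB (e i, p)) (e j, q)
  have hs : (Matrix.of fun i' j' => Matrix.vecMulVec v (star v) (e i, i') (e j, j')) =
      Matrix.single i j (1 : ℂ) := by
    ext i' j'
    simp only [Matrix.of_apply, Matrix.vecMulVec_apply, Pi.star_apply, v, Equiv.symm_apply_apply,
      Matrix.single_apply]
    split_ifs <;> simp_all
  simp only [ampliate, Matrix.of_apply, Matrix.mul_apply, Matrix.conjTranspose_apply] at h
  rw [hs] at h
  simpa using h

/-! ### Tensor products of operations preserve states -/

section Tensor

variable {ι κ : Type} [Fintype ι] [DecidableEq ι] {w : ℕ}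

theorem tensorOperation_apply (a : ι → Fin w) (b : κ → Fin w)
    (G : ∀ ν : Fin w, Operator (Bits {i // a i = ν}) →ₗ[ℂ] Operator (Bits {j // b j = ν}))
    (X : Operator (Bits ι)) (x' y' : Bits κ) :
    tensorOperation a b G X x' y' = ∑ x : Bits ι, ∑ y : Bits ι, X x y *
      ∏ ν, G ν (Matrix.single (fun i => x i) (fun i => y i) 1) (fun i => x' i) (fun i => y' i) := by
  simp [tensorOperation, tensorState, Matrix.sum_apply]

theorem tensorOperation_single (a : ι → Fin w) (b : κ → Fin w)
    (G : ∀ ν : Fin w, Operator (Bits {i // a i = ν}) →ₗ[ℂ] Operator (Bits {j // b j = ν}))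
    (x y : Bits ι) :
    tensorOperation a b G (Matrix.single x y 1) =
      tensorState b fun ν => G ν (Matrix.single (fun i => x i) (fun i => y i) 1) := by
  simp only [tensorOperation, LinearMap.coe_mk, AddHom.coe_mk]
  rw [Finset.sum_eq_single x, Finset.sum_eq_single y]
  · simp
  · intro z _ hz
    simp [hz.symm]
  · simp
  · intro z _ hz
    simp [hz.symm]
  · simp

/-- Positivity of the factors alone would not suffice; products of Kraus operators, one from each
factor, are Kraus operators of the tensor product. -/
theorem posSemidef_tensorOperation [Fintype κ] {a : ι → Fin w} {b : κ → Fin w}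
    {G : ∀ ν : Fin w, Operator (Bits {i // a i = ν}) →ₗ[ℂ] Operator (Bits {j // b j = ν})}
    (hG : ∀ ν, HasKraus (G ν)) {X : Operator (Bits ι)} (hX : X.PosSemidef) :
    (tensorOperation a b G X).PosSemidef := by
  classical
  choose S hS K hK using hG
  let KK : (∀ ν, S ν) → Matrix (Bits κ) (Bits ι) ℂ := fun s =>
    Matrix.of fun x' x => ∏ ν, K ν (s ν) (fun i => x' i) (fun i => x i)
  have h : tensorOperation a b G X = ∑ s, KK s * X * (KK s)ᴴ := by
    ext x' y'
    rw [tensorOperation_apply, Matrix.sum_apply]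
    simp_rw [hK, Finset.prod_univ_sum, Fintype.piFinset_univ, Finset.prod_mul_distrib,
      Finset.mul_sum, Matrix.mul_apply, Finset.sum_mul, Matrix.conjTranspose_apply]
    rw [Finset.sum_comm]
    simp_rw [Finset.sum_comm (s := (Finset.univ : Finset (Bits ι)))
      (t := (Finset.univ : Finset (∀ ν, S ν)))]
    refine Finset.sum_congr rfl fun s _ => Finset.sum_congr rfl fun y _ =>
      Finset.sum_congr rfl fun x _ => ?_
    simp only [KK, Matrix.of_apply, star_prod]
    ring
  rw [h]
  exact Matrix.posSemidef_sum _ fun s _ => hX.mul_mul_conjTranspose_same _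

variable [Fintype κ] [DecidableEq κ]

/-- Bit strings on `κ` are families of bit strings on the blocks of a partition of `κ`. -/
def bitsEquivBlocks (b : κ → Fin w) : Bits κ ≃ ∀ ν, Bits {j // b j = ν} where
  toFun x ν j := x j
  invFun f j := f (b j) ⟨j, rfl⟩
  left_inv x := rfl
  right_inv f := by
    funext ν ⟨j, hj⟩
    subst hj
    rfl

theorem trace_tensorState (b : κ → Fin w) (X : ∀ ν : Fin w, Operator (Bits {j // b j = ν})) :
    (tensorState b X).trace = ∏ ν, (X ν).trace := by
  simp only [Matrix.trace, Matrix.diag, Finset.prod_univ_sum, Fintype.piFinset_univ]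
  exact Fintype.sum_equiv (bitsEquivBlocks b) _ _ fun x => rfl

theorem eq_of_forall_single {m : Type} [Fintype m] [DecidableEq m] {V : Type*} [AddCommMonoid V]
    [Module ℂ V] {f g : Operator m →ₗ[ℂ] V}
    (h : ∀ x y, f (Matrix.single x y 1) = g (Matrix.single x y 1)) : f = g :=
  Matrix.ext_linearMap _ fun x y => LinearMap.ext_ring (h x y)

theorem trace_tensorOperation {a : ι → Fin w} {b : κ → Fin w}
    {G : ∀ ν : Fin w, Operator (Bits {i // a i = ν}) →ₗ[ℂ] Operator (Bits {j // b j = ν})}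
    (hG : ∀ ν X, (G ν X).trace = X.trace) (X : Operator (Bits ι)) :
    (tensorOperation a b G X).trace = X.trace := by
  have h : Matrix.traceLinearMap (Bits κ) ℂ ℂ ∘ₗ tensorOperation a b G =
      Matrix.traceLinearMap (Bits ι) ℂ ℂ := by
    refine eq_of_forall_single fun x y => ?_
    simp only [LinearMap.comp_apply, Matrix.traceLinearMap_apply, tensorOperation_single,
      trace_tensorState, hG]
    by_cases hxy : x = y
    · subst hxy
      simp
    · obtain ⟨i, hi⟩ := Function.ne_iff.1 hxy
      rw [Matrix.trace_single_eq_of_ne _ _ _ hxy]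
      refine Finset.prod_eq_zero (Finset.mem_univ (a i)) (Matrix.trace_single_eq_of_ne _ _ _ ?_)
      exact fun h => hi (congrFun h ⟨i, rfl⟩)
  exact LinearMap.congr_fun h X

theorem IsDensity.tensorOperation {a : ι → Fin w} {b : κ → Fin w}
    {G : ∀ ν : Fin w, Operator (Bits {i // a i = ν}) →ₗ[ℂ] Operator (Bits {j // b j = ν})}
    (hG : ∀ ν, HasKraus (G ν)) (hG' : ∀ ν X, (G ν X).trace = X.trace)
    {ρ : Operator (Bits ι)} (hρ : IsDensity ρ) : IsDensity (tensorOperation a b G ρ) :=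
  ⟨posSemidef_tensorOperation hG hρ.1, by rw [trace_tensorOperation hG', hρ.2]⟩

end Tensor

/-! ### Observables, their supports, and their evolution in the Heisenberg picture -/

/-- The real part of `φ` is bounded by one on states. -/
def IsBoundedObservable {m : Type} [Fintype m] (φ : Operator m →ₗ[ℂ] ℂ) : Prop :=
  ∀ ρ, IsDensity ρ → |(φ ρ).re| ≤ 1

/-- The observable `φ` only depends on the qubits in `L`. -/
structure IsSupportedOn {ι : Type} [DecidableEq ι] [Fintype ι]
    (L : Finset ι) (φ : Operator (Bits ι) →ₗ[ℂ] ℂ) : Prop where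
  eq_zero : ∀ x y : Bits ι, (∃ i ∉ L, x i ≠ y i) → φ (Matrix.single x y 1) = 0
  congr : ∀ x y x' y' : Bits ι, (∀ i ∈ L, x i = x' i ∧ y i = y' i) →
    (∀ i ∉ L, x i = y i ∧ x' i = y' i) →
    φ (Matrix.single x y 1) = φ (Matrix.single x' y' 1)

section Support

variable {ι κ : Type} [Fintype ι] [DecidableEq ι] {w : ℕ}

theorem isSupportedOn_univ (φ : Operator (Bits ι) →ₗ[ℂ] ℂ) : IsSupportedOn Finset.univ φ where
  eq_zero x y h := by simp at h
  congr x y x' y' h _ := by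
    rw [funext fun i => (h i (Finset.mem_univ i)).1, funext fun i => (h i (Finset.mem_univ i)).2]

/-- Hence an observable whose support has become empty cannot distinguish two states. -/
theorem IsSupportedOn.eq_smul_trace {φ : Operator (Bits ι) →ₗ[ℂ] ℂ} (h : IsSupportedOn ∅ φ)
    (X : Operator (Bits ι)) : φ X = φ (Matrix.single 0 0 1) * X.trace := by
  have : φ = φ (Matrix.single 0 0 1) • Matrix.traceLinearMap (Bits ι) ℂ ℂ := by
    refine eq_of_forall_single fun x y => ?_
    by_cases hxy : x = y
    · subst hxy
      simp [h.congr x x 0 0]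
    · obtain ⟨i, hi⟩ := Function.ne_iff.1 hxy
      simp [h.eq_zero x y ⟨i, by simp, hi⟩, Matrix.trace_single_eq_of_ne _ _ _ hxy]
  exact LinearMap.congr_fun this X

theorem apply_eq_sum {m : Type} [Fintype m] [DecidableEq m] (φ : Operator m →ₗ[ℂ] ℂ)
    (X : Operator m) : φ X = ∑ x, ∑ y, X x y * φ (Matrix.single x y 1) := by
  conv_lhs => rw [Matrix.matrix_eq_sum_single X]
  simp only [map_sum]
  refine Finset.sum_congr rfl fun x _ => Finset.sum_congr rfl fun y _ => ?_
  rw [← smul_eq_mul, ← map_smul, Matrix.smul_single, smul_eq_mul, mul_one]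

theorem tensorState_update_apply (b : κ → Fin w) (X : ∀ ν : Fin w, Operator (Bits {j // b j = ν}))
    (ν₀ : Fin w) (Z : Operator (Bits {j // b j = ν₀})) (x y : Bits κ) :
    tensorState b (Function.update X ν₀ Z) x y = Z (fun j => x j) (fun j => y j) *
      ∏ ν ∈ Finset.univ.erase ν₀, X ν (fun j => x j) (fun j => y j) := by
  rw [tensorState, Matrix.of_apply, ← Finset.mul_prod_erase _ _ (Finset.mem_univ ν₀),
    Function.update_self]
  congr 1
  refine Finset.prod_congr rfl fun ν hν => ?_
  rw [Function.update_of_ne (Finset.ne_of_mem_erase hν)]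

theorem tensorState_update_smul (b : κ → Fin w) (X : ∀ ν : Fin w, Operator (Bits {j // b j = ν}))
    (ν₀ : Fin w) (c : ℂ) (Z : Operator (Bits {j // b j = ν₀})) :
    tensorState b (Function.update X ν₀ (c • Z)) =
      c • tensorState b (Function.update X ν₀ Z) := by
  ext x y
  simp only [tensorState_update_apply, Matrix.smul_apply, smul_eq_mul, mul_assoc]

/-- Off the support of an observable only the trace of a tensor factor matters. -/
theorem IsSupportedOn.apply_tensorState_update [Fintype κ] [DecidableEq κ] {L : Finset κ}
    {φ : Operator (Bits κ) →ₗ[ℂ] ℂ}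
    (hφ : IsSupportedOn L φ) (b : κ → Fin w) {ν₀ : Fin w} (hν : ∀ j ∈ L, b j ≠ ν₀)
    (X : ∀ ν : Fin w, Operator (Bits {j // b j = ν})) :
    ∃ c : ℂ, ∀ Z : Operator (Bits {j // b j = ν₀}),
      φ (tensorState b (Function.update X ν₀ Z)) = c * Z.trace := by
  -- Bit strings are split into their part on block `ν₀` and the rest. The constant `c` below is
  -- evaluated with zero bits on the block, an arbitrary choice because the block misses `L`.
  let e := (Equiv.piEquivPiSubtypeProd (fun j => b j = ν₀) (fun _ => Fin 2)).symm
  have he1 : ∀ p j, (h : b j = ν₀) → e p j = p.1 ⟨j, h⟩ := fun p j h => by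
    simp [e, Equiv.piEquivPiSubtypeProd, h]
  have he2 : ∀ p j, (h : ¬ b j = ν₀) → e p j = p.2 ⟨j, h⟩ := fun p j h => by
    simp [e, Equiv.piEquivPiSubtypeProd, h]
  refine ⟨∑ p, ∑ q, (∏ ν ∈ Finset.univ.erase ν₀,
    X ν (fun j => e (0, p) j) (fun j => e (0, q) j)) * φ (Matrix.single (e (0, p)) (e (0, q)) 1),
    fun Z => ?_⟩
  rw [apply_eq_sum, ← e.sum_comp, Fintype.sum_prod_type, Finset.sum_comm, Finset.sum_mul]
  refine Finset.sum_congr rfl fun p _ => ?_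
  -- Only diagonal entries of `Z` contribute, all with the same coefficient.
  have key : ∀ p₁ q₁ q, tensorState b (Function.update X ν₀ Z) (e (p₁, p)) (e (q₁, q)) *
      φ (Matrix.single (e (p₁, p)) (e (q₁, q)) 1) = if q₁ = p₁ then
        (∏ ν ∈ Finset.univ.erase ν₀, X ν (fun j => e (0, p) j) (fun j => e (0, q) j)) *
          φ (Matrix.single (e (0, p)) (e (0, q)) 1) * Z p₁ p₁ else 0 := by
    intro p₁ q₁ q
    split_ifs with h
    · subst h
      have hφ' : φ (Matrix.single (e (q₁, p)) (e (q₁, q)) 1) =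
          φ (Matrix.single (e (0, p)) (e (0, q)) 1) := by
        by_cases hpq : ∀ j ∉ L, e (q₁, p) j = e (q₁, q) j
        · refine hφ.congr _ _ _ _ (fun j hj => ?_) fun j hj => ⟨hpq j hj, ?_⟩
          · simp [he2 _ j (hν j hj)]
          · by_cases hb : b j = ν₀
            · simp [he1 _ j hb]
            · have := hpq j hj
              simpa [he2 _ j hb] using this
        · push Not at hpq
          obtain ⟨j, hj, hne⟩ := hpq
          rw [hφ.eq_zero _ _ ⟨j, hj, hne⟩, hφ.eq_zero]
          refine ⟨j, hj, ?_⟩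
          have hb : ¬ b j = ν₀ := fun hb => by simp [he1 _ j hb] at hne
          simpa [he2 _ j hb] using hne
      rw [hφ', tensorState_update_apply]
      have h1 : ∀ r, (fun j : {j // b j = ν₀} => e (q₁, r) j) = q₁ := fun r =>
        funext fun j => he1 _ j j.2
      rw [h1, h1, Finset.prod_congr rfl (g := fun ν =>
        X ν (fun j => e (0, p) j) (fun j => e (0, q) j))]
      · ring
      · intro ν hν'
        have hne := Finset.ne_of_mem_erase hν'
        congr 1 <;> funext j <;>
          rw [he2 _ _ (fun h => hne (j.2.symm.trans h)), he2 _ _ (fun h => hne (j.2.symm.trans h))]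
    · rw [hφ.eq_zero, mul_zero]
      obtain ⟨j, hj⟩ := Function.ne_iff.1 h
      refine ⟨j, fun hL => hν _ hL j.2, ?_⟩
      rw [he1 _ _ j.2, he1 _ _ j.2]
      exact hj.symm
  simp_rw [← e.sum_comp, Fintype.sum_prod_type, key]
  rw [Finset.sum_mul, Finset.sum_congr rfl (g := fun p₁ => ∑ q,
    (∏ ν ∈ Finset.univ.erase ν₀, X ν (fun j => e (0, p) j) (fun j => e (0, q) j)) *
          φ (Matrix.single (e (0, p)) (e (0, q)) 1) * Z p₁ p₁), Finset.sum_comm]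
  · simp only [Matrix.trace, Matrix.diag, Finset.mul_sum]
  · intro p₁ _
    rw [Finset.sum_comm]
    simp

/-- If the value of `φ ∘ ⨂_ν G_ν` on a tensor product state depends only on the trace of its
factors outside `M`, then `φ ∘ ⨂_ν G_ν` is supported on the blocks in `M`. -/
theorem isSupportedOn_comp_tensorOperation {φ : Operator (Bits κ) →ₗ[ℂ] ℂ}
    {a : ι → Fin w} {b : κ → Fin w}
    {G : ∀ ν : Fin w, Operator (Bits {i // a i = ν}) →ₗ[ℂ] Operator (Bits {j // b j = ν})}
    {M : Finset (Fin w)}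
    (h : ∀ ν₀ ∉ M, ∀ X : ∀ ν : Fin w, Operator (Bits {i // a i = ν}), ∃ c : ℂ, ∀ Z,
      φ (tensorState b fun ν => G ν (Function.update X ν₀ Z ν)) = c * Z.trace) :
    IsSupportedOn (Finset.univ.filter fun i => a i ∈ M) (φ ∘ₗ tensorOperation a b G) where
  eq_zero x y hxy := by
    obtain ⟨i, hi, hne⟩ := hxy
    obtain ⟨c, hc⟩ := h (a i) (by simpa using hi)
      fun ν => Matrix.single (fun i => x i) (fun i => y i) 1
    have := hc (Matrix.single (fun i => x i) (fun i => y i) 1)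
    rw [Function.update_eq_self, Matrix.trace_single_eq_of_ne _ _ _
      fun h => hne (congrFun h ⟨i, rfl⟩), mul_zero] at this
    rw [LinearMap.comp_apply, tensorOperation_single, this]
  congr x y x' y' hL hL' := by
    let X : ∀ ν : Fin w, Operator (Bits {i // a i = ν}) :=
      fun ν => Matrix.single (fun i => x i) (fun i => y i) 1
    let X' : ∀ ν : Fin w, Operator (Bits {i // a i = ν}) :=
      fun ν => Matrix.single (fun i => x' i) (fun i => y' i) 1
    simp only [LinearMap.comp_apply, tensorOperation_single]
    -- Hybrid argument: the factors are exchanged one block at a time. In `M` the two factors agree;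
    -- outside `M` both are diagonal units, of equal trace.
    have hs : ∀ s : Finset (Fin w),
        φ (tensorState b fun ν => G ν (s.piecewise X' X ν)) =
          φ (tensorState b fun ν => G ν (X ν)) := by
      intro s
      induction s using Finset.induction_on with
      | empty => simp
      | insert ν₀ s hν₀ ih =>
        rw [Finset.piecewise_insert, ← ih]
        by_cases hM : ν₀ ∈ M
        · have : X' ν₀ = s.piecewise X' X ν₀ := by
            rw [Finset.piecewise_eq_of_notMem _ _ _ hν₀]
            have hmem : ∀ i : {i // a i = ν₀},
                i.1 ∈ Finset.univ.filter fun i => a i ∈ M := fun i => by simp [i.2, hM]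
            simp only [X, X']
            rw [funext fun i => (hL _ (hmem i)).1, funext fun i => (hL _ (hmem i)).2]
          rw [this, Function.update_eq_self]
        · obtain ⟨c, hc⟩ := h ν₀ hM (s.piecewise X' X)
          have h2 := hc (s.piecewise X' X ν₀)
          rw [Function.update_eq_self] at h2
          rw [hc, h2, Finset.piecewise_eq_of_notMem _ _ _ hν₀]
          have hmem : ∀ i : {i // a i = ν₀},
              i.1 ∉ Finset.univ.filter fun i => a i ∈ M := fun i => by simp [i.2, hM]
          simp only [X, X']
          rw [funext fun i => (hL' _ (hmem i)).1, funext fun i => (hL' _ (hmem i)).2]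
          simp
    have := hs Finset.univ
    rw [Finset.piecewise_univ] at this
    exact this.symm

/-- In the Heisenberg picture, gates pull the support of an observable back to the inputs of the
gates it meets. -/
theorem IsSupportedOn.comp_tensorOperation [Fintype κ] [DecidableEq κ] {L : Finset κ}
    {φ : Operator (Bits κ) →ₗ[ℂ] ℂ}
    (hφ : IsSupportedOn L φ) {a : ι → Fin w} {b : κ → Fin w}
    {G : ∀ ν : Fin w, Operator (Bits {i // a i = ν}) →ₗ[ℂ] Operator (Bits {j // b j = ν})}
    (hG : ∀ ν X, (G ν X).trace = X.trace) :
    IsSupportedOn (Finset.univ.filter fun i => a i ∈ L.image b) (φ ∘ₗ tensorOperation a b G) := by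
  refine isSupportedOn_comp_tensorOperation fun ν₀ hν₀ X => ?_
  obtain ⟨c, hc⟩ := hφ.apply_tensorState_update b (ν₀ := ν₀)
    (fun j hj h => hν₀ (h ▸ Finset.mem_image_of_mem b hj)) fun ν => G ν (X ν)
  refine ⟨c, fun Z => ?_⟩
  rw [← hG ν₀ Z, ← hc]
  congr 2
  funext ν
  exact Function.apply_update (fun ν => G ν) X ν₀ Z ν

end Support

/-! ### Depolarization is a quantum operation -/

section Channels

variable {m n : Type}

/-- The operation that discards its input and prepares `ω`. -/
noncomputable def replaceBy [Fintype m] (ω : Operator n) : Operator m →ₗ[ℂ] Operator n :=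
  (Matrix.traceLinearMap m ℂ ℂ).smulRight ω

theorem replaceBy_apply [Fintype m] (ω : Operator n) (X : Operator m) :
    replaceBy ω X = X.trace • ω := rfl

theorem isQuantumOperation_replaceBy [Fintype m] [Fintype n] {ω : Operator n} (hω : IsDensity ω) :
    IsQuantumOperation (replaceBy (m := m) ω) where
  trace_preserving X := by simp [replaceBy_apply, hω.2]
  completely_positive r X hX := by
    classical
    -- This sum of principal submatrices is the partial trace over the discarded system; the
    -- ampliation is its Kronecker product with `ω`.
    have h : (∑ k : m, X.submatrix (fun p : Fin r => (p, k)) (fun p => (p, k))).PosSemidef :=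
      Matrix.posSemidef_sum _ fun k _ => hX.submatrix _
    have h' : ampliate r (replaceBy ω) X =
        Matrix.kroneckerMap (fun x y => x * y) (∑ k : m, X.submatrix (fun p : Fin r => (p, k))
          (fun p => (p, k))) ω := by
      ext p q
      simp [ampliate, replaceBy_apply, Matrix.trace, Matrix.sum_apply]
    exact h' ▸ h.kronecker hω.1

theorem isQuantumOperation_id [Fintype m] :
    IsQuantumOperation (LinearMap.id : Operator m →ₗ[ℂ] Operator m) where
  trace_preserving _ := rfl
  completely_positive _ _ hX := hX

theorem IsQuantumOperation.convex [Fintype m] [Fintype n] {S T : Operator m →ₗ[ℂ] Operator n}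
    (hS : IsQuantumOperation S) (hT : IsQuantumOperation T) {t : ℝ} (ht0 : 0 ≤ t) (ht1 : t ≤ 1) :
    IsQuantumOperation ((1 - (t : ℂ)) • S + (t : ℂ) • T) where
  trace_preserving X := by
    simp only [LinearMap.add_apply, LinearMap.smul_apply, Matrix.trace_add, Matrix.trace_smul,
      hS.trace_preserving, hT.trace_preserving, smul_eq_mul]
    ring
  completely_positive r X hX := by
    have h0 : (0 : ℂ) ≤ t := by exact_mod_cast ht0
    have h1 : (0 : ℂ) ≤ 1 - (t : ℂ) := by
      have : (0 : ℝ) ≤ 1 - t := by linarith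
      exact_mod_cast this
    exact ((hS.completely_positive r X hX).smul h1).add ((hT.completely_positive r X hX).smul h0)

variable [Fintype m] [DecidableEq m]

theorem depolarize_one_apply (X : Operator m) :
    depolarize 1 X = (X.trace / (Fintype.card m : ℂ)) • (1 : Operator m) := by
  simp [depolarize]

theorem depolarize_eq (η : ℝ) : depolarize (m := m) η =
    (1 - (η : ℂ)) • LinearMap.id + (η : ℂ) • depolarize 1 := by
  refine LinearMap.ext fun X => ?_
  rw [LinearMap.add_apply, LinearMap.smul_apply, LinearMap.smul_apply, depolarize_one_apply,
    smul_smul, ← mul_div_assoc]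
  rfl

theorem isQuantumOperation_depolarize [Nonempty m] {η : ℝ} (h0 : 0 ≤ η) (h1 : η ≤ 1) :
    IsQuantumOperation (depolarize (m := m) η) := by
  have hc : (Fintype.card m : ℂ) ≠ 0 := Nat.cast_ne_zero.2 Fintype.card_ne_zero
  have hω : IsDensity ((Fintype.card m : ℂ)⁻¹ • (1 : Operator m)) :=
    ⟨Matrix.PosSemidef.one.smul (by positivity), by simp [hc]⟩
  have h : depolarize (m := m) 1 = replaceBy ((Fintype.card m : ℂ)⁻¹ • (1 : Operator m)) := by
    refine LinearMap.ext fun X => ?_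
    rw [depolarize_one_apply, replaceBy_apply, smul_smul, div_eq_mul_inv]
  rw [depolarize_eq, h]
  exact isQuantumOperation_id.convex (isQuantumOperation_replaceBy hω) h0 h1

end Channels

/-! ### Independent depolarization of qubits as a random erasure of qubits -/

/-- The gates keeping the qubits in `S` and completely depolarizing the others. -/
noncomputable def eraseGate {n : ℕ} (S : Finset (Fin n)) (ν : Fin n) :
    Operator (Bits {i // (id i : Fin n) = ν}) →ₗ[ℂ] Operator (Bits {i // (id i : Fin n) = ν}) :=
  if ν ∈ S then LinearMap.id else depolarize 1

theorem isQuantumOperation_eraseGate {n : ℕ} (S : Finset (Fin n)) (ν : Fin n) :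
    IsQuantumOperation (eraseGate S ν) := by
  unfold eraseGate
  split_ifs
  · exact isQuantumOperation_id
  · exact isQuantumOperation_depolarize zero_le_one le_rfl

/-- The probability that exactly the qubits in `S` survive. -/
noncomputable def survivalWeight (η : ℝ) {n : ℕ} (S : Finset (Fin n)) : ℝ :=
  (∏ _i ∈ S, (1 - η)) * ∏ _i ∈ Finset.univ \ S, η

theorem survivalWeight_nonneg {η : ℝ} (h0 : 0 ≤ η) (h1 : η ≤ 1) {n : ℕ} (S : Finset (Fin n)) :
    0 ≤ survivalWeight η S :=
  mul_nonneg (Finset.prod_nonneg fun _ _ => by linarith) (Finset.prod_nonneg fun _ _ => h0)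

/-- Expanding a product of sums whose erasure term at `i` is set to zero leaves exactly the subsets
containing `i`. -/
theorem sum_survivalWeight_mem (η : ℝ) {n : ℕ} (i : Fin n) :
    ∑ S, (if i ∈ S then survivalWeight η S else 0) = 1 - η := by
  have h := Finset.prod_add (fun _ : Fin n => 1 - η) (fun j => if j = i then 0 else η) Finset.univ
  rw [← Finset.mul_prod_erase _ _ (Finset.mem_univ i), Finset.prod_congr rfl (g := fun _ => 1),
    Finset.powerset_univ] at h
  · simp only [if_true, add_zero, Finset.prod_const_one, mul_one] at h
    rw [h]
    refine Finset.sum_congr rfl fun S _ => ?_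
    split_ifs with hi
    · unfold survivalWeight
      congr 1
      refine Finset.prod_congr rfl fun j hj => (if_neg ?_).symm
      rintro rfl
      simp [hi] at hj
    · rw [Finset.prod_eq_zero (s := Finset.univ \ S) (i := i) (by simp [hi]) (by simp), mul_zero]
  · intro j hj
    simp [Finset.ne_of_mem_erase hj]

/-- Linearity of expectation over the qubits of `L`. -/
theorem sum_survivalWeight_card (η : ℝ) {n : ℕ} (L : Finset (Fin n)) :
    ∑ S, survivalWeight η S * ((L ∩ S).card : ℝ) = (1 - η) * L.card := by
  have h : ∀ S, survivalWeight η S * ((L ∩ S).card : ℝ) =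
      ∑ i ∈ L, if i ∈ S then survivalWeight η S else 0 := fun S => by
    rw [← Finset.sum_filter, Finset.filter_mem_eq_inter, Finset.sum_const, nsmul_eq_mul, mul_comm]
  simp_rw [h]
  rw [Finset.sum_comm]
  simp only [sum_survivalWeight_mem, Finset.sum_const, nsmul_eq_mul, mul_comm]

/-- Each one-qubit factor is `(1 - η)` times the identity plus `η` times full erasure; multiply out.
-/
theorem qubitNoise_eq_sum (η : ℝ) (n : ℕ) : qubitNoise η n =
    ∑ S : Finset (Fin n), (survivalWeight η S : ℂ) • tensorOperation id id (eraseGate S) := by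
  refine eq_of_forall_single fun x y => ?_
  simp only [qubitNoise, tensorOperation_single, LinearMap.sum_apply, LinearMap.smul_apply]
  ext x' y'
  simp only [Matrix.sum_apply, Matrix.smul_apply, tensorState, Matrix.of_apply]
  simp_rw [depolarize_eq η, LinearMap.add_apply, LinearMap.smul_apply, Matrix.add_apply,
    Matrix.smul_apply]
  rw [Finset.prod_add, Finset.powerset_univ]
  refine Finset.sum_congr rfl fun S _ => ?_
  have hS : ∀ ν ∈ S, ∀ X, eraseGate S ν X = LinearMap.id X := fun ν hν X => by
    rw [eraseGate, if_pos hν]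
  have hS' : ∀ ν ∈ Sᶜ, ∀ X, eraseGate S ν X = depolarize 1 X := fun ν hν X => by
    rw [eraseGate, if_neg (Finset.mem_compl.1 hν)]
  have h1 := Finset.prod_congr (M := ℂ) (rfl : S = S) fun ν hν => congrFun (congrFun (hS ν hν
    (Matrix.single (fun i => x i) (fun i => y i) 1)) fun i => x' i) fun i => y' i
  have h2 := Finset.prod_congr (M := ℂ) (rfl : Sᶜ = Sᶜ) fun ν hν => congrFun (congrFun (hS' ν hν
    (Matrix.single (fun i => x i) (fun i => y i) 1)) fun i => x' i) fun i => y' i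
  rw [← Finset.prod_mul_prod_compl S (fun ν => eraseGate S ν _ _ _), h1, h2]
  simp only [smul_eq_mul, Finset.prod_mul_distrib, survivalWeight, Complex.ofReal_mul,
    Complex.ofReal_prod, Complex.ofReal_sub, Complex.ofReal_one, ← Finset.compl_eq_univ_sdiff]
  ring

/-- An erased qubit passes on only its trace; a qubit outside `L` was already seen only through its
trace. -/
theorem IsSupportedOn.comp_eraseGate {n : ℕ} {L : Finset (Fin n)}
    {φ : Operator (Bits (Fin n)) →ₗ[ℂ] ℂ} (hφ : IsSupportedOn L φ) (S : Finset (Fin n)) :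
    IsSupportedOn (L ∩ S) (φ ∘ₗ tensorOperation id id (eraseGate S)) := by
  have hL : L ∩ S = Finset.univ.filter fun i => id i ∈ L ∩ S := by ext; simp
  rw [hL]
  refine isSupportedOn_comp_tensorOperation fun ν₀ hν₀ X => ?_
  have hu : ∀ Z, (fun ν => eraseGate S ν (Function.update X ν₀ Z ν)) =
      Function.update (fun ν => eraseGate S ν (X ν)) ν₀ (eraseGate S ν₀ Z) := fun Z =>
    funext fun ν => Function.apply_update (fun ν => eraseGate S ν) X ν₀ Z ν
  simp_rw [hu]
  by_cases hνL : ν₀ ∈ L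
  · have hνS : ν₀ ∉ S := fun h => hν₀ (Finset.mem_inter.2 ⟨hνL, h⟩)
    refine ⟨φ (tensorState id (Function.update (fun ν => eraseGate S ν (X ν)) ν₀
      ((Fintype.card (Bits {i // (id i : Fin n) = ν₀}) : ℂ)⁻¹ • 1))), fun Z => ?_⟩
    rw [eraseGate, if_neg hνS, depolarize_one_apply, mul_comm, ← smul_eq_mul, ← map_smul]
    rw [← tensorState_update_smul, smul_smul, div_eq_mul_inv]
  · obtain ⟨c, hc⟩ := hφ.apply_tensorState_update id (ν₀ := ν₀)
      (fun j hj h => hνL (h ▸ hj)) fun ν => eraseGate S ν (X ν)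
    exact ⟨c, fun Z => by
      rw [hc, (isQuantumOperation_eraseGate S ν₀).trace_preserving]⟩

/-! ### Decay of distinguishability along a perturbed circuit -/

section Decay

variable {n m : ℕ}

/-- Bounded observables on `ℓ` qubits have expectation at most `c * ℓ` in `A`. -/
def LocallyBounded (c : ℝ) (A : Operator (Bits (Fin n))) : Prop :=
  ∀ (L : Finset (Fin n)) (φ : Operator (Bits (Fin n)) →ₗ[ℂ] ℂ), IsSupportedOn L φ →
    IsBoundedObservable φ → (φ A).re ≤ c * L.card

/-- The difference of expectations is at most `2`, hence at most `2 * L.card` for nonempty `L`; for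
empty `L` it vanishes because the traces agree. -/
theorem locallyBounded_sub {ρ σ : Operator (Bits (Fin n))} (hρ : IsDensity ρ) (hσ : IsDensity σ) :
    LocallyBounded 2 (ρ - σ) := by
  intro L φ hφ hb
  rw [map_sub, Complex.sub_re]
  rcases L.eq_empty_or_nonempty with rfl | hL
  · rw [hφ.eq_smul_trace ρ, hφ.eq_smul_trace σ, hρ.2, hσ.2]
    simp
  · have h1 := (abs_le.1 (hb ρ hρ)).2
    have h2 := (abs_le.1 (hb σ hσ)).1
    have h3 : (1 : ℝ) ≤ L.card := by exact_mod_cast hL.card_pos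
    linarith

theorem IsBoundedObservable.comp_tensorOperation {φ : Operator (Bits (Fin m)) →ₗ[ℂ] ℂ}
    (hφ : IsBoundedObservable φ) {w : ℕ} {a : Fin n → Fin w} {b : Fin m → Fin w}
    {G : ∀ ν : Fin w, Operator (Bits {i // a i = ν}) →ₗ[ℂ] Operator (Bits {j // b j = ν})}
    (hG : ∀ ν, IsQuantumOperation (G ν)) : IsBoundedObservable (φ ∘ₗ tensorOperation a b G) :=
  fun _ hρ => hφ _ (hρ.tensorOperation (fun ν => (hG ν).hasKraus)
    fun ν => (hG ν).trace_preserving)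

/-- `L` meets at most `L.card` gates, each with at most `k` inputs. -/
theorem LocallyBounded.level {k : ℕ} {T : Operator (Bits (Fin n)) →ₗ[ℂ] Operator (Bits (Fin m))}
    (hT : IsLevel k T) {c : ℝ} (hc : 0 ≤ c) {A : Operator (Bits (Fin n))}
    (hA : LocallyBounded c A) : LocallyBounded (k * c) (T A) := by
  obtain ⟨w, a, b, G, hG, rfl⟩ := hT
  intro L φ hφ hb
  refine (hA _ _ (hφ.comp_tensorOperation fun ν => (hG ν).1.trace_preserving)
    (hb.comp_tensorOperation fun ν => (hG ν).1)).trans ?_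
  have hcard : (Finset.univ.filter fun i => a i ∈ L.image b).card ≤ k * L.card := by
    refine (Finset.card_le_mul_card_image_of_maps_to (f := a) (t := L.image b)
      (fun i hi => (Finset.mem_filter.1 hi).2) k fun ν _ => ?_).trans
      (Nat.mul_le_mul_left k Finset.card_image_le)
    refine le_trans ?_ (hG ν).2
    rw [Fintype.card_subtype]
    exact Finset.card_le_card (Finset.filter_subset_filter _ (Finset.subset_univ _))
  calc c * ((Finset.univ.filter fun i => a i ∈ L.image b).card : ℝ)
      ≤ c * ((k * L.card : ℕ) : ℝ) := by gcongr
    _ = k * c * L.card := by push_cast; ring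

theorem LocallyBounded.qubitNoise {η : ℝ} (h0 : 0 ≤ η) (h1 : η ≤ 1) {c : ℝ}
    {A : Operator (Bits (Fin n))} (hA : LocallyBounded c A) :
    LocallyBounded ((1 - η) * c) (qubitNoise η n A) := by
  intro L φ hφ hb
  have h : (φ (NoisyCircuit.qubitNoise η n A)).re = ∑ S : Finset (Fin n),
      survivalWeight η S * ((φ ∘ₗ tensorOperation id id (eraseGate S)) A).re := by
    simp [qubitNoise_eq_sum]
  rw [h]
  calc _ ≤ ∑ S : Finset (Fin n), survivalWeight η S * (c * ((L ∩ S).card : ℝ)) :=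
        Finset.sum_le_sum fun S _ => mul_le_mul_of_nonneg_left
          (hA _ _ (hφ.comp_eraseGate S)
            (hb.comp_tensorOperation (isQuantumOperation_eraseGate S)))
          (survivalWeight_nonneg h0 h1 S)
    _ = (1 - η) * c * L.card := by
        rw [mul_right_comm, ← sum_survivalWeight_card, Finset.sum_mul]
        exact Finset.sum_congr rfl fun S _ => by ring

/-- The factor by which a perturbed circuit of the given depth contracts. -/
noncomputable def decayFactor (k : ℕ) (r : ℝ) : ℕ → ℝ
  | 0 => 1
  | t + 1 => k * r ^ t

theorem decayFactor_nonneg (k : ℕ) {r : ℝ} (hr : 0 ≤ r) : ∀ t, 0 ≤ decayFactor k r t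
  | 0 => zero_le_one
  | _ + 1 => mul_nonneg (Nat.cast_nonneg k) (pow_nonneg hr _)

theorem LocallyBounded.mono {c c' : ℝ} (h : c ≤ c') {A : Operator (Bits (Fin n))}
    (hA : LocallyBounded c A) : LocallyBounded c' A := fun L φ hφ hb =>
  (hA L φ hφ hb).trans (mul_le_mul_of_nonneg_right h (Nat.cast_nonneg _))

theorem locallyBounded_noisyRun {k : ℕ} {η r : ℝ} (h0 : 0 ≤ η) (h1 : η ≤ 1) (hr : 0 ≤ r)
    (hkr : k * (1 - η) ≤ r) (Q : Circuit k n m) {ρ σ : Operator (Bits (Fin n))}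
    (hρ : IsDensity ρ) (hσ : IsDensity σ) :
    LocallyBounded (2 * decayFactor k r Q.depth) (Q.noisyRun η (ρ - σ)) := by
  induction Q with
  | empty => simpa [Circuit.noisyRun, Circuit.depth, decayFactor] using locallyBounded_sub hρ hσ
  | step Q T hT ih =>
    have hc := decayFactor_nonneg k hr Q.depth
    simp only [Circuit.noisyRun, Circuit.depth]
    -- No noise precedes the first level, which costs a full factor `k`; every later one costs `k *
    -- (1 - η) ≤ r`.
    split_ifs with hd
    · rw [hd] at ih
      refine (LocallyBounded.level hT (by simp [decayFactor]) ih).mono ?_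
      simp [hd, decayFactor, mul_comm]
    · refine (LocallyBounded.level hT ?_ (ih.qubitNoise h0 h1)).mono ?_
      · exact mul_nonneg (by linarith) (by linarith)
      · obtain ⟨t, ht⟩ := Nat.exists_eq_succ_of_ne_zero hd
        rw [ht]
        simp only [decayFactor, pow_succ]
        calc (k : ℝ) * ((1 - η) * (2 * (k * r ^ t))) = (2 * (k * r ^ t)) * (k * (1 - η)) := by ring
          _ ≤ (2 * (k * r ^ t)) * r := by gcongr
          _ = 2 * (k * (r ^ t * r)) := by ring

end Decay

/-! ### The trace norm is attained by a bounded observable -/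

section TraceNorm

variable {m : Type} [Fintype m] [DecidableEq m]

/-- The observable `X ↦ tr (U X)`. -/
noncomputable def traceObservable (U : Operator m) : Operator m →ₗ[ℂ] ℂ :=
  Matrix.traceLinearMap m ℂ ℂ ∘ₗ LinearMap.mulLeft ℂ U

theorem re_trace_mul_nonneg {A B : Operator m} (hA : A.PosSemidef) (hB : B.PosSemidef) :
    0 ≤ (A * B).trace.re := by
  obtain ⟨C, rfl⟩ := exists_eq_conjTranspose_mul_self hB
  rw [← mul_assoc, Matrix.trace_mul_comm, ← mul_assoc]
  exact (Complex.nonneg_iff.1 (hA.mul_mul_conjTranspose_same C).trace_nonneg).1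

theorem isBoundedObservable_traceObservable {U : Operator m} (hU : (1 - U * Uᴴ).PosSemidef) :
    IsBoundedObservable (traceObservable U) := by
  intro ρ hρ
  have h1 := re_trace_mul_nonneg hρ.1 hU
  have hconj : (ρ * Uᴴ).trace.re = (U * ρ).trace.re := by
    have : (ρ * Uᴴ).trace = star (U * ρ).trace := by
      rw [← Matrix.trace_conjTranspose, Matrix.conjTranspose_mul, hρ.1.isHermitian.eq]
    rw [this]
    rfl
  -- Expand `0 ≤ tr (ρ (U - c)(U - c)ᴴ)` and use `tr (ρ U Uᴴ) ≤ 1`; the signs `c = ±1` give the two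
  -- bounds.
  have key : ∀ c : ℝ, c ^ 2 = 1 → c * (U * ρ).trace.re ≤ 1 := by
    intro c hc
    have h2 := re_trace_mul_nonneg hρ.1
      (Matrix.posSemidef_self_mul_conjTranspose (U - (c : ℂ) • (1 : Operator m)))
    have h3 : ρ * ((U - (c : ℂ) • (1 : Operator m)) * (U - (c : ℂ) • (1 : Operator m))ᴴ) =
        ρ * (U * Uᴴ) - (c : ℂ) • (ρ * U) - (c : ℂ) • (ρ * Uᴴ) + ((c ^ 2 : ℝ) : ℂ) • ρ := by
      simp only [Matrix.conjTranspose_sub, Matrix.conjTranspose_smul, Matrix.conjTranspose_one,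
        sub_mul, mul_sub, smul_mul_assoc, mul_smul_comm, one_mul, mul_one, smul_sub, smul_smul]
      simp only [RCLike.star_def, Complex.conj_ofReal, Complex.ofReal_mul, pow_two]
      abel
    rw [h3, hc] at h2
    rw [mul_sub, mul_one, Matrix.trace_sub, Complex.sub_re, hρ.2] at h1
    simp only [Matrix.trace_add, Matrix.trace_sub, Matrix.trace_smul, smul_eq_mul, Complex.add_re,
      Complex.sub_re, Complex.re_ofReal_mul, hconj, hρ.2, Matrix.trace_mul_comm ρ U,
      Complex.one_re] at h1 h2
    linarith
  have hp := key 1 (by norm_num)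
  have hm := key (-1) (by norm_num)
  rw [abs_le]
  simp only [traceObservable, LinearMap.comp_apply, LinearMap.mulLeft_apply,
    Matrix.traceLinearMap_apply]
  constructor <;> linarith

/-- Polar decomposition: the observable is the trace against the adjoint of the partial isometry of
`A`. -/
theorem exists_isBoundedObservable_eq_traceNorm (A : Operator m) :
    ∃ φ : Operator m →ₗ[ℂ] ℂ, IsBoundedObservable φ ∧ (φ A).re = traceNorm A := by
  have hH := Matrix.isHermitian_conjTranspose_mul_self A
  set μ := hH.eigenvalues with hμ
  have hμ0 : ∀ i, 0 ≤ μ i := Matrix.eigenvalues_conjTranspose_mul_self_nonneg A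
  set W : Operator m := (hH.eigenvectorUnitary : Operator m) with hW
  have hWW : Wᴴ * W = 1 := Unitary.coe_star_mul_self hH.eigenvectorUnitary
  have hWW' : W * Wᴴ = 1 := Unitary.coe_mul_star_self hH.eigenvectorUnitary
  let D (d : m → ℝ) : Operator m := Matrix.diagonal fun i => (d i : ℂ)
  have hD : ∀ d e, D d * D e = D fun i => d i * e i := fun d e => by
    simp [D, Matrix.diagonal_mul_diagonal]
  have hDH : ∀ d, (D d)ᴴ = D d := fun d => by
    simp only [D, Matrix.diagonal_conjTranspose]
    congr 1
    funext i
    simp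
  have hspec : Wᴴ * (Aᴴ * A) * W = D μ := by
    have h := hH.spectral_theorem
    rw [Unitary.conjStarAlgAut_apply] at h
    have h' : Aᴴ * A = W * D μ * Wᴴ := h
    rw [h']
    calc Wᴴ * (W * D μ * Wᴴ) * W = (Wᴴ * W) * D μ * (Wᴴ * W) := by noncomm_ring
      _ = D μ := by rw [hWW, one_mul, mul_one]
  -- A pseudo-inverse: the convention `0⁻¹ = 0` makes the operator vanish where `Aᴴ * A` does.
  let d : m → ℝ := fun i => (Real.sqrt (μ i))⁻¹
  have hdμ : ∀ i, d i * μ i = Real.sqrt (μ i) := fun i => by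
    conv_lhs => rw [← Real.mul_self_sqrt (hμ0 i)]
    simp only [d]
    by_cases h : Real.sqrt (μ i) = 0
    · simp [h]
    · rw [inv_mul_cancel_left₀]
      exact h
  refine ⟨traceObservable (W * D d * Wᴴ * Aᴴ), isBoundedObservable_traceObservable ?_, ?_⟩
  · have h : (1 : Operator m) - W * D d * Wᴴ * Aᴴ * (W * D d * Wᴴ * Aᴴ)ᴴ =
        W * D (fun i => 1 - Real.sqrt (μ i) * d i) * Wᴴ := by
      have h1 : W * D d * Wᴴ * Aᴴ * (W * D d * Wᴴ * Aᴴ)ᴴ =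
          W * D (fun i => Real.sqrt (μ i) * d i) * Wᴴ := by
        simp only [Matrix.conjTranspose_mul, Matrix.conjTranspose_conjTranspose, hDH]
        calc W * D d * Wᴴ * Aᴴ * (A * (W * (D d * Wᴴ)))
            = W * (D d * (Wᴴ * (Aᴴ * A) * W) * D d) * Wᴴ := by noncomm_ring
          _ = _ := by rw [hspec, hD, hD]; simp only [hdμ]
      have h2 : D (fun i => 1 - Real.sqrt (μ i) * d i) =
          1 - D (fun i => Real.sqrt (μ i) * d i) := by
        simp only [D, ← Matrix.diagonal_one, Matrix.diagonal_sub, Complex.ofReal_sub,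
          Complex.ofReal_one]
      rw [h1, h2, mul_sub, sub_mul, mul_one, hWW']
    rw [h]
    refine Matrix.PosSemidef.mul_mul_conjTranspose_same (Matrix.PosSemidef.diagonal fun i => ?_) W
    have : (0 : ℝ) ≤ 1 - Real.sqrt (μ i) * d i := by
      rw [sub_nonneg]
      exact mul_inv_le_one
    exact Complex.zero_le_real.2 this
  · simp only [traceObservable, LinearMap.comp_apply, LinearMap.mulLeft_apply,
      Matrix.traceLinearMap_apply]
    have h : (W * D d * Wᴴ * Aᴴ * A).trace = (D fun i => Real.sqrt (μ i)).trace := by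
      calc (W * D d * Wᴴ * Aᴴ * A).trace = (W * (D d * Wᴴ * (Aᴴ * A))).trace := by
            congr 1; noncomm_ring
        _ = (D d * (Wᴴ * (Aᴴ * A) * W)).trace := by
            rw [Matrix.trace_mul_comm]; congr 1; noncomm_ring
        _ = _ := by rw [hspec, hD]; simp only [hdμ]
    rw [h]
    simp [D, traceNorm, Matrix.trace_diagonal, hμ]

end TraceNorm

theorem traceDist_le_of_locallyBounded {n m : ℕ} {c : ℝ}
    {F : Operator (Bits (Fin n)) →ₗ[ℂ] Operator (Bits (Fin m))} {ρ σ : Operator (Bits (Fin n))}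
    (h : LocallyBounded (2 * c) (F (ρ - σ))) : traceDist (F ρ) (F σ) ≤ c * m := by
  obtain ⟨φ, hb, hφ⟩ := exists_isBoundedObservable_eq_traceNorm (F ρ - F σ)
  have := h Finset.univ φ (isSupportedOn_univ φ) hb
  rw [map_sub, hφ, Finset.card_univ, Fintype.card_fin] at this
  rw [traceDist]
  linarith

/-! ### Probabilities of measurement outcomes -/

section Probability

variable {m : ℕ}

/-- The projection onto the outcome `1` of qubit `j`. -/
noncomputable def outcomeProjection (j : Fin m) : Operator (Bits (Fin m)) :=
  Matrix.diagonal fun y => if y j = 1 then 1 else 0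

theorem isBoundedObservable_outcomeProjection (j : Fin m) :
    IsBoundedObservable (traceObservable (outcomeProjection j)) := by
  refine isBoundedObservable_traceObservable ?_
  have h : (1 : Operator (Bits (Fin m))) - outcomeProjection j * (outcomeProjection j)ᴴ =
      Matrix.diagonal fun y => if y j = 1 then 0 else 1 := by
    rw [outcomeProjection, Matrix.diagonal_conjTranspose, Matrix.diagonal_mul_diagonal,
      ← Matrix.diagonal_one, Matrix.diagonal_sub]
    congr 1
    funext y
    by_cases hy : y j = 1 <;> simp [hy]
  rw [h]
  refine Matrix.PosSemidef.diagonal fun y => ?_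
  by_cases hy : y j = 1 <;> simp [hy]

theorem traceObservable_outcomeProjection_re (j : Fin m) (ρ : Operator (Bits (Fin m))) :
    (traceObservable (outcomeProjection j) ρ).re = probOne ρ j := by
  simp only [traceObservable, LinearMap.comp_apply, LinearMap.mulLeft_apply,
    Matrix.traceLinearMap_apply, Matrix.trace, Matrix.diag, outcomeProjection,
    Matrix.diagonal_mul, Complex.re_sum, probOne]
  refine Finset.sum_congr rfl fun y _ => ?_
  split_ifs <;> simp

theorem isSupportedOn_outcomeProjection (j : Fin m) :
    IsSupportedOn {j} (traceObservable (outcomeProjection j)) := by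
  have h : ∀ x y : Bits (Fin m), traceObservable (outcomeProjection j) (Matrix.single x y 1) =
      if x = y ∧ x j = 1 then 1 else 0 := fun x y => by
    simp only [traceObservable, LinearMap.comp_apply, LinearMap.mulLeft_apply,
      Matrix.traceLinearMap_apply, outcomeProjection]
    rw [Matrix.trace_mul_comm, Matrix.trace_single_mul]
    by_cases hxy : x = y
    · subst hxy; simp
    · simp [hxy, Ne.symm hxy]
  refine ⟨fun x y ⟨i, _, hi⟩ => ?_, fun x y x' y' hL hL' => ?_⟩
  · rw [h, if_neg fun hxy => hi (congrFun hxy.1 i)]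
  · rw [h, h]
    have hj := hL j (Finset.mem_singleton_self j)
    have hiff : x = y ↔ x' = y' := by
      simp only [funext_iff]
      refine forall_congr' fun i => ?_
      by_cases hi : i ∈ ({j} : Finset (Fin m))
      · rw [(hL i hi).1, (hL i hi).2]
      · simp [hL' i hi]
    simp only [hiff, hj.1]

theorem isDensity_single {ι : Type} [Fintype ι] [DecidableEq ι] (x : ι) :
    IsDensity (Matrix.single x x (1 : ℂ)) := by
  refine ⟨?_, by simp⟩
  rw [← Matrix.diagonal_single]
  exact Matrix.PosSemidef.diagonal (Pi.single_nonneg.2 zero_le_one)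

/-- The measurement is supported on one qubit, so the width does not enter. -/
theorem probOne_sub_le {k n : ℕ} {η r : ℝ} (h0 : 0 ≤ η) (h1 : η ≤ 1) (hr : 0 ≤ r)
    (hkr : k * (1 - η) ≤ r) (Q : Circuit k n m) (j : Fin m) (x y : Bits (Fin n)) :
    probOne (Q.noisyRun η (basisState x)) j - probOne (Q.noisyRun η (basisState y)) j ≤
      2 * decayFactor k r Q.depth := by
  have h := locallyBounded_noisyRun h0 h1 hr hkr Q (isDensity_single x) (isDensity_single y)
    {j} _ (isSupportedOn_outcomeProjection j) (isBoundedObservable_outcomeProjection j)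
  rw [map_sub, map_sub, Complex.sub_re, traceObservable_outcomeProjection_re,
    traceObservable_outcomeProjection_re] at h
  simpa [basisState] using h

end Probability

/-! ### Noiseless circuits -/

theorem Circuit.le_width {k n m : ℕ} (Q : Circuit k n m) : m ≤ Q.width := by
  cases Q <;> simp [Circuit.width]

theorem isLevel_qubitNoise {k : ℕ} (hk : 0 < k) {η : ℝ} (h0 : 0 ≤ η) (h1 : η ≤ 1) (n : ℕ) :
    IsLevel k (qubitNoise η n) := by
  refine ⟨n, id, id, fun _ => depolarize η,
    fun ν => ⟨isQuantumOperation_depolarize h0 h1, ?_⟩, rfl⟩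
  have : Subsingleton {i : Fin n // id i = ν} :=
    ⟨fun i j => Subtype.ext (i.2.trans j.2.symm)⟩
  exact Fintype.card_le_one_iff_subsingleton.2 this |>.trans hk

/-- Noise may be implemented by gates, at the price of doubling the depth. -/
theorem Circuit.exists_run_eq_noisyRun {k n m : ℕ} (hk : 0 < k) {η : ℝ} (h0 : 0 ≤ η) (h1 : η ≤ 1)
    (Q : Circuit k n m) : ∃ Q' : Circuit k n m,
      Q'.depth ≤ 2 * Q.depth ∧ Q'.width = Q.width ∧ Q'.run = Q.noisyRun η := by
  induction Q with
  | empty => exact ⟨.empty, by simp [Circuit.depth], rfl, rfl⟩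
  | @step l _ Q T hT ih =>
    obtain ⟨Q', hd, hw, hr⟩ := ih
    by_cases hQ : Q.depth = 0
    · refine ⟨Q'.step T hT, ?_, ?_, ?_⟩
      · simp only [Circuit.depth]; omega
      · simp only [Circuit.width, hw]
      · simp only [Circuit.run, Circuit.noisyRun, hr, if_pos hQ]
    · refine ⟨(Q'.step _ (isLevel_qubitNoise hk h0 h1 l)).step T hT, ?_, ?_, ?_⟩
      · simp only [Circuit.depth]; omega
      · simp only [Circuit.width, hw, max_eq_left Q.le_width]
      · simp only [Circuit.run, Circuit.noisyRun, hr, if_neg hQ]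

theorem exists_circuit_const {k : ℕ} (hk : 0 < k) (n : ℕ) (v : Fin 2) :
    ∃ Q : Circuit k n 1, Q.depth = 1 ∧ Q.width = max n 1 ∧ Computes Q.run 0 fun _ => v := by
  -- Each input qubit gets its own gate that discards it; the extra last gate has no input and
  -- prepares the output bit.
  let a : Fin n → Fin (n + 1) := Fin.castSucc
  let b : Fin 1 → Fin (n + 1) := fun _ => Fin.last n
  let G : ∀ ν, Operator (Bits {i // a i = ν}) →ₗ[ℂ] Operator (Bits {j // b j = ν}) :=
    fun ν => replaceBy (Matrix.single (fun _ => v) (fun _ => v) 1)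
  have hT : IsLevel k (tensorOperation a b G) := by
    refine ⟨n + 1, a, b, G, fun ν => ⟨isQuantumOperation_replaceBy (isDensity_single _), ?_⟩, rfl⟩
    have : Subsingleton {i : Fin n // a i = ν} :=
      ⟨fun i j => Subtype.ext (Fin.castSucc_injective n (i.2.trans j.2.symm))⟩
    exact Fintype.card_le_one_iff_subsingleton.2 this |>.trans hk
  refine ⟨Circuit.empty.step _ hT, rfl, rfl, fun x => ?_⟩
  have hp : probOne (tensorOperation a b G (basisState x)) 0 = if v = 1 then 1 else 0 := by
    have hy : ∀ y, tensorOperation a b G (basisState x) y y = if y 0 = v then 1 else 0 := by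
      intro y
      rw [basisState, tensorOperation_single, tensorState, Matrix.of_apply]
      simp only [G, replaceBy_apply, Matrix.trace_single_eq_same, one_smul]
      split_ifs with h
      · refine Finset.prod_eq_one fun ν _ => ?_
        have : (fun j : {j // b j = ν} => y j) = fun _ => v := funext fun j => by
          rw [← h, Subsingleton.elim j.1 0]
        rw [this, Matrix.single_apply_same]
      · refine Finset.prod_eq_zero (Finset.mem_univ (Fin.last n)) 
          (Matrix.single_apply_of_ne _ _ _ _ _ ?_)
        exact fun hv => h (congrFun hv.1 ⟨0, rfl⟩).symm
    simp only [probOne, hy]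
    rw [Finset.sum_eq_single (fun _ => 1)]
    · by_cases hv : v = 1
      · simp [hv]
      · simp [hv, Ne.symm hv]
    · intro y _ hy'
      rw [if_neg]
      exact fun h => hy' (funext fun i => by rw [Subsingleton.elim i 0, h])
    · simp
  have hr : (Circuit.empty.step _ hT).run = tensorOperation a b G := rfl
  rw [hr, hp]
  constructor <;> intro h <;> norm_num [h]

/-! ### The main theorem -/

theorem NoisyQP_subset_QNC1 {η : ℝ} (hη : 1 / 2 < η) (h1 : η ≤ 1) : NoisyQP η ⊆ QNC1 := by
  rintro f ⟨p, hp⟩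
  set r : ℝ := 2 * (1 - η) with hr
  have hr0 : 0 ≤ r := by linarith
  have hr1 : r < 1 := by linarith
  -- Beyond depth `N` the outcome probabilities differ by at most `2 * 2 * r ^ N < 1/3`, less than
  -- the gap between `2/3` and `1/3`.
  obtain ⟨N, hN⟩ := exists_pow_lt_of_lt_one (show (0 : ℝ) < 1 / 12 by norm_num) hr1
  refine ⟨p + Polynomial.X + 1, (2 * (N + 1) : ℕ) / Real.log 2, fun n => ?_⟩
  have hlog2 : 0 < Real.log 2 := Real.log_pos one_lt_two
  have hlog : ∀ d : ℕ, d ≤ 2 * (N + 1) →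
      (d : ℝ) ≤ (2 * (N + 1) : ℕ) / Real.log 2 * Real.log (n + 2) := by
    intro d hd
    rw [div_mul_eq_mul_div, le_div_iff₀ hlog2]
    have h2 : Real.log 2 ≤ Real.log (n + 2) :=
      Real.log_le_log two_pos (by linarith [(Nat.cast_nonneg n : (0 : ℝ) ≤ n)])
    have hd' : (d : ℝ) ≤ (2 * (N + 1) : ℕ) := by exact_mod_cast hd
    gcongr
  obtain ⟨m, Q, j, hd, hw, hc⟩ := hp n
  by_cases hQ : Q.depth ≤ N
  · obtain ⟨Q', hd', hw', hr'⟩ :=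
      Q.exists_run_eq_noisyRun two_pos (by linarith : (0 : ℝ) ≤ η) h1
    refine ⟨m, Q', j, hlog _ (by omega), ?_, hr' ▸ hc⟩
    simp only [Polynomial.eval_add, Polynomial.eval_X, Polynomial.eval_one]
    omega
  · have hconst : ∀ x y, f n x = 1 → f n y = 0 → False := by
      intro x y hx hy
      have h := probOne_sub_le (by linarith : (0 : ℝ) ≤ η) h1 hr0 (by rw [hr]; norm_num) Q j x y
      obtain ⟨t, ht⟩ := Nat.exists_eq_succ_of_ne_zero (show Q.depth ≠ 0 by omega)
      rw [ht, decayFactor] at h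
      have h3 : r ^ t ≤ r ^ N := pow_le_pow_of_le_one hr0 hr1.le (by omega)
      have := (hc x).1 hx
      have := (hc y).2 hy
      push_cast at h
      linarith
    obtain ⟨Q', hd', hw', hc'⟩ := exists_circuit_const two_pos n (f n 0)
    refine ⟨1, Q', 0, hlog _ (by omega), ?_, ?_⟩
    · simp only [Polynomial.eval_add, Polynomial.eval_X, Polynomial.eval_one]
      omega
    · have heq : ∀ u v : Fin 2, (u = 1 → v = 0 → False) → (v = 1 → u = 0 → False) → u = v := by
        decide
      have : f n = fun _ => f n 0 := funext fun x => heq _ _ (hconst x 0) (hconst 0 x)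
      rw [this]
      exact hc'

/-- Dividing by `r` absorbs the missing noise layer; depth zero is covered because `r ≤ 1 ≤ k`. -/
theorem decayFactor_le {k : ℕ} (hk : 0 < k) {r : ℝ} (hr0 : 0 < r) (hr1 : r ≤ 1) (t : ℕ) :
    decayFactor k r t ≤ k / r * Real.exp (Real.log r * t) := by
  rw [mul_comm (Real.log r), Real.exp_nat_mul, Real.exp_log hr0]
  cases t with
  | zero =>
    rw [pow_zero, mul_one, decayFactor, le_div_iff₀ hr0, one_mul]
    exact hr1.trans (by exact_mod_cast hk)
  | succ t => rw [decayFactor, pow_succ]; apply le_of_eq; field_simp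

theorem exists_constants {k : ℕ} {η : ℝ} (hk : 0 < k) (hη : 1 - 1 / (k : ℝ) < η) (h1 : η ≤ 1) :
    ∃ C : ℝ, 0 < C ∧ ∃ K : ℝ, 0 < K ∧ ∀ (n m : ℕ) (Q : Circuit k n m),
      (C * Real.log (Q.width : ℝ) ≤ (Q.depth : ℝ) →
        (Q.width = 1 → C ≤ (Q.depth : ℝ)) →
        PracticallyWorthless (Q.noisyRun η)) ∧
      (C * Real.log (m : ℝ) ≤ (Q.depth : ℝ) →
        ∀ ρ σ : Operator (Bits (Fin n)), IsDensity ρ → IsDensity σ →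
          (m : ℝ) * traceDist (Q.noisyRun η ρ) (Q.noisyRun η σ) ≤ K) := by
  have hk0 : (0 : ℝ) < k := by exact_mod_cast hk
  have hk1 : (1 : ℝ) ≤ k := by exact_mod_cast hk
  have hη0 : 0 ≤ η := by
    have : 1 / (k : ℝ) ≤ 1 := by rw [div_le_one hk0]; exact hk1
    linarith
  -- The maximum keeps `r` positive, so that `Real.log r` is meaningful, even at `η = 1`.
  set r : ℝ := max (k * (1 - η)) (1 / 2) with hr
  have hr0 : 0 < r := lt_max_of_lt_right (by norm_num)
  have hr1 : r < 1 := by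
    refine max_lt ?_ (by norm_num)
    have : 1 - η < 1 / k := by linarith
    rwa [lt_div_iff₀ hk0, mul_comm] at this
  set l : ℝ := -Real.log r with hl
  have hl0 : 0 < l := neg_pos.2 (Real.log_neg hr0 hr1)
  -- Chosen so that `k / r = exp B / 100`.
  set B : ℝ := l + Real.log (100 * k) with hB
  have hB0 : 0 < B := add_pos_of_pos_of_nonneg hl0 (Real.log_nonneg (by linarith))
  have hlog2 : 0 < Real.log 2 := Real.log_pos one_lt_two
  have hlog2' : Real.log 2 ≤ 1 := by linarith [Real.log_two_lt_d9]
  -- For width at least `2`, the first summand pays for `B`. The `2` pays for the factor `m` in (a)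
  -- and for `m ^ 2` in (b).
  set C : ℝ := (B / Real.log 2 + 2) / l with hC
  have hC0 : 0 < C := by positivity
  have hlC : l * C = B / Real.log 2 + 2 := mul_div_cancel₀ _ hl0.ne'
  refine ⟨C, hC0, k / r, by positivity, fun n m Q => ?_⟩
  have hdist : ∀ ρ σ : Operator (Bits (Fin n)), IsDensity ρ → IsDensity σ →
      traceDist (Q.noisyRun η ρ) (Q.noisyRun η σ) ≤
        k / r * Real.exp (-(l * Q.depth)) * m := fun ρ σ hρ hσ => by
    refine (traceDist_le_of_locallyBounded (locallyBounded_noisyRun hη0 h1 hr0.le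
      (le_max_left _ _) Q hρ hσ)).trans ?_
    have h := decayFactor_le hk hr0 hr1.le Q.depth
    rw [show Real.log r * Q.depth = -(l * Q.depth) by rw [hl]; ring] at h
    gcongr
  refine ⟨fun hd hd1 ρ σ hρ hσ => (hdist ρ σ hρ hσ).trans ?_,
    fun hd ρ σ hρ hσ => (mul_le_mul_of_nonneg_left (hdist ρ σ hρ hσ) (Nat.cast_nonneg m)).trans ?_⟩
  · rcases Nat.eq_zero_or_pos Q.width with hw | hw
    · have : m = 0 := by have := Q.le_width; omega
      simp [this]
    · have hw0 : (0 : ℝ) < Q.width := by exact_mod_cast hw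
      have hmw : (m : ℝ) ≤ Real.exp (Real.log Q.width) := by
        rw [Real.exp_log hw0]; exact_mod_cast Q.le_width
      have hmain : B + Real.log Q.width ≤ l * Q.depth := by
        rcases (Nat.succ_le_of_lt hw).eq_or_lt with hw1 | hw2
        · have hd2 := mul_le_mul_of_nonneg_left (hd1 hw1.symm) hl0.le
          have : B ≤ B / Real.log 2 := le_div_self hB0.le hlog2 hlog2'
          rw [← hw1]
          simp only [Nat.succ_eq_add_one, zero_add, Nat.cast_one, Real.log_one, add_zero]
          linarith
        · have hd2 := mul_le_mul_of_nonneg_left hd hl0.le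
          have hlw : Real.log 2 ≤ Real.log Q.width :=
            Real.log_le_log two_pos (by exact_mod_cast hw2)
          have h3 : B ≤ B / Real.log 2 * Real.log Q.width := by
            rw [div_mul_eq_mul_div, le_div_iff₀ hlog2]
            gcongr
          rw [← mul_assoc, hlC] at hd2
          linarith
      have hkr : (k : ℝ) / r = Real.exp B / 100 := by
        rw [hB, Real.exp_add, hl, Real.exp_neg, Real.exp_log hr0, Real.exp_log (by linarith)]
        field_simp
      calc (k : ℝ) / r * Real.exp (-(l * Q.depth)) * m
          ≤ Real.exp B / 100 * Real.exp (-(l * Q.depth)) * Real.exp (Real.log Q.width) := by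
            rw [hkr]; gcongr
        _ = Real.exp (B + -(l * Q.depth) + Real.log Q.width) / 100 := by
            rw [Real.exp_add (B + _), Real.exp_add B]; ring
        _ ≤ 1 / 100 := by
            gcongr
            exact Real.exp_le_one_iff.2 (by linarith)
  · rcases Nat.eq_zero_or_pos m with hm | hm
    · subst hm
      simp only [Nat.cast_zero, zero_mul]
      positivity
    · have hm0 : (0 : ℝ) < m := by exact_mod_cast hm
      have hd2 := mul_le_mul_of_nonneg_left hd hl0.le
      have hlm : 0 ≤ Real.log m := Real.log_nonneg (by exact_mod_cast hm)
      have h2 : 0 ≤ B / Real.log 2 * Real.log m := by positivity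
      rw [← mul_assoc, hlC] at hd2
      calc (m : ℝ) * (k / r * Real.exp (-(l * Q.depth)) * m)
          = k / r * (Real.exp (Real.log m) * Real.exp (Real.log m) * Real.exp (-(l * Q.depth))) := by
            rw [Real.exp_log hm0]; ring
        _ = k / r * Real.exp (Real.log m + Real.log m + -(l * Q.depth)) := by
            rw [Real.exp_add, Real.exp_add]
        _ ≤ k / r * 1 := by
            gcongr
            exact Real.exp_le_one_iff.2 (by linarith)
        _ = k / r := mul_one _

end NoisyCircuit

open NoisyCircuit
theorem mainTheorem1 :
    (∀ (k : ℕ) (η : ℝ), 0 < k → 1 - 1 / (k : ℝ) < η → η ≤ 1 →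
      ∃ C : ℝ, 0 < C ∧ ∃ K : ℝ, 0 < K ∧ ∀ (n m : ℕ) (Q : Circuit k n m),
        (C * Real.log (Q.width : ℝ) ≤ (Q.depth : ℝ) →
          (Q.width = 1 → C ≤ (Q.depth : ℝ)) →
          PracticallyWorthless (Q.noisyRun η)) ∧
        (C * Real.log (m : ℝ) ≤ (Q.depth : ℝ) →
          ∀ ρ σ : Operator (Bits (Fin n)), IsDensity ρ → IsDensity σ →
            (m : ℝ) * traceDist (Q.noisyRun η ρ) (Q.noisyRun η σ) ≤ K)) ∧
    (¬ QP ⊆ QNC1 → faultToleranceThreshold ≤ 1 / 2) := by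
  refine ⟨fun k η hk hη h1 => exists_constants hk hη h1, fun h => ?_⟩
  -- Nonnegativity of the bound covers an empty set, whose `sSup` is `0`.
  refine Real.sSup_le ?_ (by norm_num)
  rintro η ⟨_, h1, hQ⟩
  by_contra! hη
  exact h (hQ.trans (NoisyQP_subset_QNC1 hη h1))
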